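/- Let $R$ be a commutative integral domain with $1$ that contains the field of rational numbers ($\mathbb{Q}=\mathbb{Q}\cdot 1\subseteq R$) and is radically Noetherian, i.e. satisfies the ascending chain condition for radical ideals. Let $m\ge 0$ be an integer and $C_m=R[x_1,\dots,x_m]$ with the derivations $\partial_i=\partial/\partial x_i$. Let $L_m$ be the left-symmetric Witt algebra over $R$: the $R$-module of formal sums $f_1\partial_1+\dots+f_m\partial_m$ with $f_i\in C_m$ and the bilinear product determined by $$f\partial_i\circ g\partial_j=f\,\partial_i(g)\,\partial_j ,\qquad f,g\in C_m .$$ Let $W_m$ be the Witt algebra over $R$, i.e. the Lie algebra on the same module with bracket $[u,v]=u\circ v-v\circ u$. For an $R$-algebra $A$ (not necessarily associative or unital), a variety $\mathfrak M$ of $R$-algebras containing $A$, and $n\ge 0$, let $B=A\sqcup_{\mathfrak M}\mathfrak M\langle y_1,\dots,y_n\rangle$ be the coproduct in $\mathfrak M$ of $A$ and the free algebra of $\mathfrak M$ on $y_1,\dots,y_n$. For $f\in B$ and $a\in A^n$ let $f(a)\in A$ be the image of $f$ under the homomorphism $B\to A$ that is the identity on $A$ and sends $y_i$ to $a_i$.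 For $S\subseteq B$ put $Z(S)=\{a\in A^n : f(a)=0 \text{ for all } f\in S\}$. The Zariski topology on $A^n$ is the coarsest topology in which all sets $Z(S)$ are closed. The algebra $A$ is called equationally Noetherian if for every such $\mathfrak M$ and every $n$ the space $A^n$ with this topology is Noetherian (the topology does not depend on the choice of $\mathfrak M$). Then (a) the left-symmetric Witt algebra $L_m$ over $R$ is equationally Noetherian; (b) the Witt algebra $W_m$ over $R$ is equationally Noetherian. -/

import Mathlib

/-- A commutative ring is radically Noetherian if its radical ideals satisfy the ascending chain
condition. -/
def IsRadicallyNoetherian (R : Type*) [CommRing R] : Prop :=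
  WellFoundedGT {I : Ideal R // I.IsRadical}

namespace EqNoeth

/-! ### Varieties of algebras, free algebras, coproducts

Throughout, "`R`-algebra" means a not necessarily associative, not necessarily unital algebra over
the commutative ring `R`.  A variety is given by a set of identities, i.e. of elements of the free
`R`-algebra on countably many letters. -/

/-- A variety of `R`-algebras, given by its defining identities. -/
structure AlgVariety (R : Type*) [CommRing R] where
  /-- the identities `p = 0` which define the variety -/
  identities : Set (FreeNonUnitalNonAssocAlgebra R ℕ)

section Varieties

variable {R : Type*} [CommRing R]

/-- The algebra `A` belongs to the variety `M`. -/
def AlgVariety.Contains (M : AlgVariety R) (A : Type*) [NonUnitalNonAssocRing A] [Module R A]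
    [IsScalarTower R A A] [SMulCommClass R A A] : Prop :=
  ∀ p ∈ M.identities, ∀ v : ℕ → A, FreeNonUnitalNonAssocAlgebra.lift R v p = 0

/-- The two-sided ideals of the free algebra on `X` that contain `rel` and all values of the
identities of `M`. -/
def AlgVariety.IsAdmissibleIdeal (M : AlgVariety R) {X : Type*}
    (rel : Set (FreeNonUnitalNonAssocAlgebra R X))
    (J : Submodule R (FreeNonUnitalNonAssocAlgebra R X)) : Prop :=
  (∀ f g, g ∈ J → f * g ∈ J ∧ g * f ∈ J) ∧ rel ⊆ J ∧
    ∀ p ∈ M.identities, ∀ v : ℕ → FreeNonUnitalNonAssocAlgebra R X,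
      FreeNonUnitalNonAssocAlgebra.lift R v p ∈ J

/-- The smallest ideal of the free algebra on `X` that contains `rel` and all values of the
identities of `M`. -/
noncomputable def AlgVariety.relIdeal (M : AlgVariety R) {X : Type*}
    (rel : Set (FreeNonUnitalNonAssocAlgebra R X)) :
    Submodule R (FreeNonUnitalNonAssocAlgebra R X) :=
  sInf {J | M.IsAdmissibleIdeal rel J}

theorem AlgVariety.relIdeal_isAdmissible (M : AlgVariety R) {X : Type*}
    (rel : Set (FreeNonUnitalNonAssocAlgebra R X)) :
    M.IsAdmissibleIdeal rel (M.relIdeal rel) := by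
  refine ⟨fun f g hg => ⟨?_, ?_⟩, fun r hr => ?_, fun p hp v => ?_⟩
  · exact Submodule.mem_sInf.2 fun J hJ => (hJ.1 f g (Submodule.mem_sInf.1 hg J hJ)).1
  · exact Submodule.mem_sInf.2 fun J hJ => (hJ.1 f g (Submodule.mem_sInf.1 hg J hJ)).2
  · exact Submodule.mem_sInf.2 fun J hJ => hJ.2.1 hr
  · exact Submodule.mem_sInf.2 fun J hJ => hJ.2.2 p hp v

/-- The algebra of the variety `M` with generators `X` and relations `r = 0`, `r ∈ rel`. -/
def AlgVariety.Presented (M : AlgVariety R) {X : Type*}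
    (rel : Set (FreeNonUnitalNonAssocAlgebra R X)) : Type _ :=
  FreeNonUnitalNonAssocAlgebra R X ⧸ M.relIdeal rel

namespace AlgVariety.Presented

variable (M : AlgVariety R) {X : Type*} (rel : Set (FreeNonUnitalNonAssocAlgebra R X))

noncomputable instance : AddCommGroup (M.Presented rel) :=
  inferInstanceAs (AddCommGroup (FreeNonUnitalNonAssocAlgebra R X ⧸ M.relIdeal rel))

noncomputable instance : Module R (M.Presented rel) :=
  inferInstanceAs (Module R (FreeNonUnitalNonAssocAlgebra R X ⧸ M.relIdeal rel))

/-- The quotient map, as a linear map. -/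
noncomputable def mk : FreeNonUnitalNonAssocAlgebra R X →ₗ[R] M.Presented rel :=
  (M.relIdeal rel).mkQ

theorem mk_surjective : Function.Surjective (mk M rel) :=
  (M.relIdeal rel).mkQ_surjective

theorem mk_eq_mk {f g : FreeNonUnitalNonAssocAlgebra R X} :
    mk M rel f = mk M rel g ↔ f - g ∈ M.relIdeal rel :=
  Submodule.Quotient.eq _

noncomputable instance : Mul (M.Presented rel) where
  mul := Quotient.map₂ (· * ·) (by
    intro a a' ha b b' hb
    have ha' := (Submodule.quotientRel_def _).1 ha
    have hb' := (Submodule.quotientRel_def _).1 hb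
    refine (Submodule.quotientRel_def _).2 ?_
    have h : a * b - a' * b' = (a - a') * b + a' * (b - b') := by
      rw [sub_mul, mul_sub]; abel
    rw [h]
    exact add_mem (((M.relIdeal_isAdmissible rel).1 b _ ha').2)
      (((M.relIdeal_isAdmissible rel).1 a' _ hb').1))

theorem mk_mul (f g : FreeNonUnitalNonAssocAlgebra R X) :
    mk M rel (f * g) = mk M rel f * mk M rel g := rfl

noncomputable instance : NonUnitalNonAssocRing (M.Presented rel) where
  left_distrib a b c := by
    obtain ⟨a, rfl⟩ := mk_surjective M rel a
    obtain ⟨b, rfl⟩ := mk_surjective M rel b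
    obtain ⟨c, rfl⟩ := mk_surjective M rel c
    rw [← map_add, ← mk_mul, ← mk_mul, ← mk_mul, ← map_add, mul_add]
  right_distrib a b c := by
    obtain ⟨a, rfl⟩ := mk_surjective M rel a
    obtain ⟨b, rfl⟩ := mk_surjective M rel b
    obtain ⟨c, rfl⟩ := mk_surjective M rel c
    rw [← map_add, ← mk_mul, ← mk_mul, ← mk_mul, ← map_add, add_mul]
  zero_mul a := by
    obtain ⟨a, rfl⟩ := mk_surjective M rel a
    rw [← map_zero (mk M rel), ← mk_mul, zero_mul]
  mul_zero a := by
    obtain ⟨a, rfl⟩ := mk_surjective M rel a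
    rw [← map_zero (mk M rel), ← mk_mul, mul_zero]

instance : IsScalarTower R (M.Presented rel) (M.Presented rel) where
  smul_assoc r a b := by
    obtain ⟨a, rfl⟩ := mk_surjective M rel a
    obtain ⟨b, rfl⟩ := mk_surjective M rel b
    simp only [smul_eq_mul]
    rw [← map_smul, ← mk_mul, ← mk_mul, ← map_smul, smul_mul_assoc]

instance : SMulCommClass R (M.Presented rel) (M.Presented rel) where
  smul_comm r a b := by
    obtain ⟨a, rfl⟩ := mk_surjective M rel a
    obtain ⟨b, rfl⟩ := mk_surjective M rel b
    simp only [smul_eq_mul]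
    rw [← map_smul, ← mk_mul, ← mk_mul, ← map_smul, mul_smul_comm]

/-- The quotient map, as a homomorphism of algebras. -/
noncomputable def mkHom : FreeNonUnitalNonAssocAlgebra R X →ₙₐ[R] M.Presented rel :=
  { mk M rel with
    map_zero' := map_zero (mk M rel)
    map_mul' := mk_mul M rel }

/-- The image of a generator. -/
noncomputable def gen (x : X) : M.Presented rel :=
  mkHom M rel (FreeNonUnitalNonAssocAlgebra.of R x)

theorem contains : M.Contains (M.Presented rel) := by
  intro p hp v
  choose w hw using fun i => mk_surjective M rel (v i)
  have h : FreeNonUnitalNonAssocAlgebra.lift R v =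
      (mkHom M rel).comp (FreeNonUnitalNonAssocAlgebra.lift R w) := by
    refine FreeNonUnitalNonAssocAlgebra.hom_ext R fun x => ?_
    rw [NonUnitalAlgHom.comp_apply, FreeNonUnitalNonAssocAlgebra.lift_of_apply,
      FreeNonUnitalNonAssocAlgebra.lift_of_apply]
    exact (hw x).symm
  rw [h, NonUnitalAlgHom.comp_apply]
  exact (Submodule.Quotient.mk_eq_zero _).2 ((M.relIdeal_isAdmissible rel).2.2 p hp w)

variable {M rel}

variable {C : Type*} [NonUnitalNonAssocRing C] [Module R C] [IsScalarTower R C C]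
  [SMulCommClass R C C]

theorem relIdeal_le_ker (hC : M.Contains C) (u : X → C)
    (hu : ∀ r ∈ rel, FreeNonUnitalNonAssocAlgebra.lift R u r = 0) :
    M.relIdeal rel ≤
      LinearMap.ker (FreeNonUnitalNonAssocAlgebra.lift R u : _ →ₗ[R] C) := by
  refine sInf_le ⟨fun f g hg => ?_, fun r hr => hu r hr, fun p hp v => ?_⟩
  · have hg' : FreeNonUnitalNonAssocAlgebra.lift R u g = 0 := hg
    constructor
    · change FreeNonUnitalNonAssocAlgebra.lift R u (f * g) = 0
      rw [map_mul, hg', mul_zero]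
    · change FreeNonUnitalNonAssocAlgebra.lift R u (g * f) = 0
      rw [map_mul, hg', zero_mul]
  · have h : FreeNonUnitalNonAssocAlgebra.lift R
          (fun i => FreeNonUnitalNonAssocAlgebra.lift R u (v i)) =
        (FreeNonUnitalNonAssocAlgebra.lift R u).comp
          (FreeNonUnitalNonAssocAlgebra.lift R v) := by
      refine FreeNonUnitalNonAssocAlgebra.hom_ext R fun x => ?_
      simp only [NonUnitalAlgHom.comp_apply, FreeNonUnitalNonAssocAlgebra.lift_of_apply]
    have h' := hC p hp (fun i => FreeNonUnitalNonAssocAlgebra.lift R u (v i))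
    rw [h] at h'
    exact h'

/-- The linear map underlying `lift`. -/
noncomputable def liftLinear (hC : M.Contains C) (u : X → C)
    (hu : ∀ r ∈ rel, FreeNonUnitalNonAssocAlgebra.lift R u r = 0) : M.Presented rel →ₗ[R] C :=
  (M.relIdeal rel).liftQ (FreeNonUnitalNonAssocAlgebra.lift R u : _ →ₗ[R] C)
    (relIdeal_le_ker hC u hu)

theorem liftLinear_mk (hC : M.Contains C) (u : X → C)
    (hu : ∀ r ∈ rel, FreeNonUnitalNonAssocAlgebra.lift R u r = 0)
    (f : FreeNonUnitalNonAssocAlgebra R X) :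
    liftLinear hC u hu (mk M rel f) = FreeNonUnitalNonAssocAlgebra.lift R u f :=
  Submodule.liftQ_apply _ _ _

/-- The homomorphism to an algebra `C` of the variety given by images of the generators that
satisfy the relations. -/
noncomputable def lift (hC : M.Contains C) (u : X → C)
    (hu : ∀ r ∈ rel, FreeNonUnitalNonAssocAlgebra.lift R u r = 0) : M.Presented rel →ₙₐ[R] C :=
  { liftLinear hC u hu with
    map_zero' := map_zero (liftLinear hC u hu)
    map_mul' := by
      intro a b
      obtain ⟨a, rfl⟩ := mk_surjective M rel a
      obtain ⟨b, rfl⟩ := mk_surjective M rel b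
      change liftLinear hC u hu (mk M rel a * mk M rel b) =
        liftLinear hC u hu (mk M rel a) * liftLinear hC u hu (mk M rel b)
      rw [← mk_mul, liftLinear_mk, liftLinear_mk, liftLinear_mk, map_mul] }

theorem lift_mkHom (hC : M.Contains C) (u : X → C)
    (hu : ∀ r ∈ rel, FreeNonUnitalNonAssocAlgebra.lift R u r = 0)
    (f : FreeNonUnitalNonAssocAlgebra R X) :
    lift hC u hu (mkHom M rel f) = FreeNonUnitalNonAssocAlgebra.lift R u f :=
  liftLinear_mk hC u hu f

theorem lift_gen (hC : M.Contains C) (u : X → C)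
    (hu : ∀ r ∈ rel, FreeNonUnitalNonAssocAlgebra.lift R u r = 0) (x : X) :
    lift hC u hu (gen M rel x) = u x := by
  unfold gen
  rw [lift_mkHom, FreeNonUnitalNonAssocAlgebra.lift_of_apply]

theorem hom_ext {φ ψ : M.Presented rel →ₙₐ[R] C}
    (h : ∀ x, φ (gen M rel x) = ψ (gen M rel x)) : φ = ψ := by
  have h' : φ.comp (mkHom M rel) = ψ.comp (mkHom M rel) :=
    FreeNonUnitalNonAssocAlgebra.hom_ext R h
  ext a
  obtain ⟨a, rfl⟩ := mk_surjective M rel a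
  exact NonUnitalAlgHom.congr_fun h' a

end AlgVariety.Presented

/-- The free algebra `M⟨X⟩` of the variety `M`, freely generated by `X`. -/
abbrev AlgVariety.Free (M : AlgVariety R) (X : Type*) : Type _ :=
  M.Presented (∅ : Set (FreeNonUnitalNonAssocAlgebra R X))

/-- The homomorphism from the free algebra of a variety given by the images of the free
generators. -/
noncomputable def AlgVariety.Free.lift {M : AlgVariety R} {X C : Type*}
    [NonUnitalNonAssocRing C] [Module R C] [IsScalarTower R C C] [SMulCommClass R C C]
    (hC : M.Contains C) (u : X → C) : M.Free X →ₙₐ[R] C :=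
  Presented.lift hC u fun _ hr => hr.elim

section Coproduct

variable (M : AlgVariety R) (A B : Type*) [NonUnitalNonAssocRing A] [Module R A]
  [NonUnitalNonAssocRing B] [Module R B]

/-- The relations that make a map `j` from `A` to a free algebra an algebra homomorphism. -/
def homRelations {X : Type*} (j : A → FreeNonUnitalNonAssocAlgebra R X) :
    Set (FreeNonUnitalNonAssocAlgebra R X) :=
  {r | (∃ a b, r = j (a + b) - (j a + j b)) ∨ (∃ (c : R) (a : A), r = j (c • a) - c • j a) ∨
    ∃ a b, r = j (a * b) - j a * j b}

/-- The relations between the generators `A ⊕ B` which define the coproduct of `A` and `B`. -/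
def coprodRelations : Set (FreeNonUnitalNonAssocAlgebra R (A ⊕ B)) :=
  homRelations A (fun a => FreeNonUnitalNonAssocAlgebra.of R (Sum.inl a)) ∪
    homRelations B (fun b => FreeNonUnitalNonAssocAlgebra.of R (Sum.inr b))

/-- The coproduct (free product) `A ⊔ B` in the variety `M`. -/
abbrev AlgVariety.Coprod : Type _ := M.Presented (coprodRelations (R := R) A B)

variable {M A B}

variable {C : Type*} [NonUnitalNonAssocRing C] [Module R C] [IsScalarTower R C C]
  [SMulCommClass R C C]

theorem lift_eq_zero_of_mem_homRelations {X : Type*} (u : X → C) (φ : A →ₙₐ[R] C) (k : A → X)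
    (hk : ∀ a, u (k a) = φ a) (r : FreeNonUnitalNonAssocAlgebra R X)
    (hr : r ∈ homRelations A (fun a => FreeNonUnitalNonAssocAlgebra.of R (k a))) :
    FreeNonUnitalNonAssocAlgebra.lift R u r = 0 := by
  rcases hr with ⟨a, b, rfl⟩ | ⟨c, a, rfl⟩ | ⟨a, b, rfl⟩
  · simp only [map_sub, map_add, FreeNonUnitalNonAssocAlgebra.lift_of_apply, hk, sub_self]
  · simp only [map_sub, map_smul, FreeNonUnitalNonAssocAlgebra.lift_of_apply, hk, sub_self]
  · simp only [map_sub, map_mul, FreeNonUnitalNonAssocAlgebra.lift_of_apply, hk, sub_self]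

theorem lift_eq_zero_of_mem_coprodRelations (φ : A →ₙₐ[R] C) (ψ : B →ₙₐ[R] C)
    (r : FreeNonUnitalNonAssocAlgebra R (A ⊕ B)) (hr : r ∈ coprodRelations A B) :
    FreeNonUnitalNonAssocAlgebra.lift R (Sum.elim φ ψ) r = 0 :=
  hr.elim (lift_eq_zero_of_mem_homRelations _ φ Sum.inl (fun _ => rfl) r)
    (lift_eq_zero_of_mem_homRelations _ ψ Sum.inr (fun _ => rfl) r)

/-- The homomorphism from the coproduct that is given by homomorphisms on `A` and on `B`. -/
noncomputable def AlgVariety.Coprod.lift (hC : M.Contains C) (φ : A →ₙₐ[R] C) (ψ : B →ₙₐ[R] C) :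
    M.Coprod A B →ₙₐ[R] C :=
  Presented.lift hC (Sum.elim φ ψ) (lift_eq_zero_of_mem_coprodRelations φ ψ)

/-- The relations `homRelations` do make the map an algebra homomorphism. -/
noncomputable def AlgVariety.homOfRelations {X : Type*} {rel : Set (FreeNonUnitalNonAssocAlgebra R X)}
    (k : A → X)
    (h : homRelations A (fun a => FreeNonUnitalNonAssocAlgebra.of R (k a)) ⊆ rel) :
    A →ₙₐ[R] M.Presented rel :=
  have key : ∀ {f g : FreeNonUnitalNonAssocAlgebra R X},
      f - g ∈ homRelations A (fun a => FreeNonUnitalNonAssocAlgebra.of R (k a)) →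
        Presented.mkHom M rel f = Presented.mkHom M rel g := fun hfg =>
    (Presented.mk_eq_mk M rel).2 ((M.relIdeal_isAdmissible rel).2.1 (h hfg))
  have hadd : ∀ a b : A, Presented.gen M rel (k (a + b)) =
      Presented.gen M rel (k a) + Presented.gen M rel (k b) := fun a b =>
    (key (Or.inl ⟨a, b, rfl⟩)).trans (map_add _ _ _)
  { toFun := fun a => Presented.gen M rel (k a)
    map_add' := hadd
    map_zero' := by simpa using hadd 0 0
    map_smul' := fun c a => (key (Or.inr (Or.inl ⟨c, a, rfl⟩))).trans (map_smul _ _ _)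
    map_mul' := fun a b => (key (Or.inr (Or.inr ⟨a, b, rfl⟩))).trans (map_mul _ _ _) }

variable (M A B) in
/-- The canonical homomorphism from `A` to the coproduct. -/
noncomputable def AlgVariety.Coprod.inl : A →ₙₐ[R] M.Coprod A B :=
  AlgVariety.homOfRelations Sum.inl Set.subset_union_left

variable (M A B) in
/-- The canonical homomorphism from `B` to the coproduct. -/
noncomputable def AlgVariety.Coprod.inr : B →ₙₐ[R] M.Coprod A B :=
  AlgVariety.homOfRelations Sum.inr Set.subset_union_right

theorem AlgVariety.Coprod.lift_inl (hC : M.Contains C) (φ : A →ₙₐ[R] C) (ψ : B →ₙₐ[R] C)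
    (a : A) : lift hC φ ψ (inl M A B a) = φ a :=
  Presented.lift_gen hC (Sum.elim φ ψ) (lift_eq_zero_of_mem_coprodRelations φ ψ) (Sum.inl a)

theorem AlgVariety.Coprod.lift_inr (hC : M.Contains C) (φ : A →ₙₐ[R] C) (ψ : B →ₙₐ[R] C)
    (b : B) : lift hC φ ψ (inr M A B b) = ψ b :=
  Presented.lift_gen hC (Sum.elim φ ψ) (lift_eq_zero_of_mem_coprodRelations φ ψ) (Sum.inr b)

/-- The universal property of the coproduct. -/
theorem AlgVariety.Coprod.existsUnique_hom (hC : M.Contains C) (φ : A →ₙₐ[R] C)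
    (ψ : B →ₙₐ[R] C) :
    ∃! χ : M.Coprod A B →ₙₐ[R] C, χ.comp (inl M A B) = φ ∧ χ.comp (inr M A B) = ψ := by
  refine ⟨lift hC φ ψ, ⟨NonUnitalAlgHom.ext (lift_inl hC φ ψ),
    NonUnitalAlgHom.ext (lift_inr hC φ ψ)⟩, ?_⟩
  rintro χ ⟨rfl, rfl⟩
  refine Presented.hom_ext ?_
  rintro (a | b)
  · exact (lift_inl hC (χ.comp (inl M A B)) (χ.comp (inr M A B)) a).symm
  · exact (lift_inr hC (χ.comp (inl M A B)) (χ.comp (inr M A B)) b).symm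

end Coproduct

/-! ### The Zariski topology and equationally Noetherian algebras -/

section Zariski

variable {M : AlgVariety R} {A : Type*}
  [NonUnitalNonAssocRing A] [Module R A] [IsScalarTower R A A] [SMulCommClass R A A]

/-- The algebra `A ⊔ M⟨x₁, …, xₙ⟩` of equations over `A` in `n` unknowns, the coproduct being taken
in the variety `M`. -/
abbrev EquationAlgebra (M : AlgVariety R) (A : Type*)
    [NonUnitalNonAssocRing A] [Module R A] [IsScalarTower R A A] [SMulCommClass R A A] (n : ℕ) :
    Type _ :=
  M.Coprod A (M.Free (Fin n))

/-- The value `f(a₁, …, aₙ)`: the image of `f` under the homomorphism to `A` which is the identity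
on `A` and maps `xᵢ` to `aᵢ`. -/
noncomputable def evalAt (hA : M.Contains A) {n : ℕ} (a : Fin n → A) :
    EquationAlgebra M A n →ₙₐ[R] A :=
  AlgVariety.Coprod.lift hA (NonUnitalAlgHom.id R A) (AlgVariety.Free.lift hA a)

/-- The set `Z(S)` of common zeros of `S` in `Aⁿ`. -/
def zeroSet (hA : M.Contains A) {n : ℕ} (S : Set (EquationAlgebra M A n)) : Set (Fin n → A) :=
  {a | ∀ f ∈ S, evalAt hA a f = 0}

/-- The Zariski topology on `Aⁿ`: the coarsest topology for which all sets `Z(S)` are closed. -/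
abbrev zariskiTopology (hA : M.Contains A) (n : ℕ) : TopologicalSpace (Fin n → A) :=
  TopologicalSpace.generateFrom {U | ∃ S : Set (EquationAlgebra M A n), U = (zeroSet hA S)ᶜ}

end Zariski

/-- An `R`-algebra `A` is equationally Noetherian if, for every variety `M` of `R`-algebras that
contains `A`, all the spaces `Aⁿ` are Noetherian in the Zariski topology. -/
def IsEquationallyNoetherian (R : Type*) [CommRing R] (A : Type*) [NonUnitalNonAssocRing A]
    [Module R A] [IsScalarTower R A A] [SMulCommClass R A A] : Prop :=
  ∀ (M : AlgVariety R) (hA : M.Contains A) (n : ℕ),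
    @TopologicalSpace.NoetherianSpace (Fin n → A) (zariskiTopology hA n)

end Varieties

/-! ### Witt algebras of differential algebras -/

/-- A differential structure on the commutative `R`-algebra `A`: pairwise commuting `R`-linear
derivations `δ₁, …, δₘ`. -/
structure DifferentialStructure (R A : Type*) [CommRing R] [CommRing A] [Algebra R A]
    (m : ℕ) where
  /-- the basic derivations -/
  δ : Fin m → Derivation R A A
  comm : ∀ i j a, δ i (δ j a) = δ j (δ i a)

section Witt

variable {R A : Type*} [CommRing R] [CommRing A] [Algebra R A] {m : ℕ}

/-- The space of the left-symmetric Witt algebra `L(A)`: the family `f` stands for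
`f₁ δ₁ + ⋯ + fₘ δₘ`. -/
def LeftSymmetricWitt (_D : DifferentialStructure R A m) : Type _ := Fin m → A

namespace LeftSymmetricWitt

variable (D : DifferentialStructure R A m)

instance : AddCommGroup (LeftSymmetricWitt D) := inferInstanceAs (AddCommGroup (Fin m → A))

instance : Module R (LeftSymmetricWitt D) := inferInstanceAs (Module R (Fin m → A))

/-- The product given by `f δᵢ ∘ g δⱼ = f δᵢ(g) δⱼ`. -/
instance : Mul (LeftSymmetricWitt D) where
  mul f g := fun j => ∑ i, f i * D.δ i (g j)

variable {D}

theorem mul_apply (f g : LeftSymmetricWitt D) (j : Fin m) :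
    (f * g) j = ∑ i, f i * D.δ i (g j) := rfl

theorem add_apply (f g : LeftSymmetricWitt D) (j : Fin m) : (f + g) j = f j + g j := rfl

theorem sub_apply (f g : LeftSymmetricWitt D) (j : Fin m) : (f - g) j = f j - g j := rfl

theorem zero_apply (j : Fin m) : (0 : LeftSymmetricWitt D) j = 0 := rfl

theorem smul_apply (r : R) (f : LeftSymmetricWitt D) (j : Fin m) : (r • f) j = r • f j := rfl

variable (D)

instance : NonUnitalNonAssocRing (LeftSymmetricWitt D) where
  left_distrib f g h := by
    funext j
    simp only [mul_apply, add_apply, map_add, mul_add, Finset.sum_add_distrib]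
  right_distrib f g h := by
    funext j
    simp only [mul_apply, add_apply, add_mul, Finset.sum_add_distrib]
  zero_mul f := by
    funext j
    simp only [mul_apply, zero_apply, zero_mul, Finset.sum_const_zero]
  mul_zero f := by
    funext j
    simp only [mul_apply, zero_apply, map_zero, mul_zero, Finset.sum_const_zero]

variable {D} in
theorem associator_apply' (f g h : LeftSymmetricWitt D) (j : Fin m) :
    associator f g h j = -∑ i, ∑ k, f i * g k * D.δ i (D.δ k (h j)) := by
  rw [associator_apply, sub_apply]
  simp only [mul_apply, Finset.sum_mul, map_sum, Derivation.leibniz, smul_eq_mul, Finset.mul_sum,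
    mul_add, Finset.sum_add_distrib]
  rw [Finset.sum_comm (f := fun i k => f k * D.δ k (g i) * D.δ i (h j)), sub_eq_iff_eq_add,
    ← add_assoc]
  simp only [mul_assoc, mul_comm (D.δ _ (h j)), neg_add_cancel, zero_add]

instance : LeftPreLieRing (LeftSymmetricWitt D) where
  assoc_symm' f g h := by
    funext j
    rw [associator_apply', associator_apply', Finset.sum_comm]
    refine congrArg _ (Finset.sum_congr rfl fun i _ => Finset.sum_congr rfl fun k _ => ?_)
    rw [D.comm k i, mul_comm (f k)]

instance : LeftPreLieAlgebra R (LeftSymmetricWitt D) where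
  smul_assoc r f g := by
    funext j
    simp only [smul_eq_mul, mul_apply, smul_apply, Finset.smul_sum, smul_mul_assoc]
  smul_comm r f g := by
    funext j
    simp only [smul_eq_mul, mul_apply, smul_apply, Finset.smul_sum]
    exact Finset.sum_congr rfl fun i _ => by
      rw [Derivation.map_smul (D.δ i) r (g j), mul_smul_comm]

end LeftSymmetricWitt

/-- The Witt algebra `W(A)`: the Lie algebra on the space of `L(A)` with the bracket
`⁅x, y⁆ = x ∘ y - y ∘ x`. -/
abbrev WittAlgebra (D : DifferentialStructure R A m) : Type _ := LeftSymmetricWitt D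

theorem WittAlgebra.lie_def (D : DifferentialStructure R A m) (x y : WittAlgebra D) :
    ⁅x, y⁆ = x * y - y * x := rfl

end Witt

/-- The differential algebra `R[x₁, …, xₘ]` with the derivations `∂/∂xᵢ`. -/
noncomputable def polyDiff (R : Type*) [CommRing R] (m : ℕ) :
    DifferentialStructure R (MvPolynomial (Fin m) R) m where
  δ := MvPolynomial.pderiv
  comm i j f := by
    let p : Fin m → Derivation R (MvPolynomial (Fin m) R) (MvPolynomial (Fin m) R) :=
      MvPolynomial.pderiv
    have h : ⁅p i, p j⁆ = 0 := by
      refine MvPolynomial.derivation_ext fun k => ?_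
      rw [Derivation.commutator_apply, MvPolynomial.pderiv_X, MvPolynomial.pderiv_X,
        Pi.single_apply, Pi.single_apply]
      split_ifs <;> simp
    have h' : ⁅p i, p j⁆ f = 0 := by rw [h]; rfl
    rw [Derivation.commutator_apply] at h'
    exact sub_eq_zero.1 h'

end EqNoeth

/-!
The theorem reduces to a form of the Ritt–Raudenbush basis theorem: every system of algebraic
partial differential equations, with coefficients in a radically Noetherian ring of constants that
contains `ℚ`, has the same solutions as a finite subsystem.

*Reduction.*  In coordinates, the products of the two Witt algebras are differential polynomials in
the coefficients of the factors.  Hence the value at `a` of an element of the equation algebra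
has coordinates that are differential polynomials in the coordinates of `a`
(`evalAt_mem_of_const_mem_of_coord_mem`).  Its coefficients lie in `R[x₁, …, xₘ]`; they are removed
by treating `x₁, …, xₘ` as additional unknowns with fixed values, so that only the ring
`MvPolynomial V R` with constant coefficients is needed, where `V` is the set of jet variables
`δ^α yₖ`.  A point yields the kernel of the evaluation at it, which is a prime ideal stable under
the derivations since `R[x₁, …, xₘ]` is a domain.  A finite subsystem for every system gives the
Noetherian property of the topology by Alexander's subbasis theorem
(`noetherianSpace_zariskiTopology`).

*Basis theorem.*  If some set of differential polynomials is not equivalent to a finite subset, a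
maximal such set exists by Zorn's lemma, and maximality makes it a prime differential ideal `P`
(`finitelyDetermined_of_forall_prime`).  It then suffices to find a finite `F ⊆ P` and `H ∉ P`
such that every prime differential ideal that contains `F` but not `H` contains `P`.  The variables
are well-ordered compatibly with differentiation.  Call `u` a leader if it is algebraic modulo `P`
over the smaller variables.  By Dickson's lemma all leaders are derivatives of finitely many of them;
`F` consists of a relation of minimal degree for each of these, together with finitely many
constants, and `H` is the product of the leading coefficients and separants of the relations.  The
inclusion `P ≤ Q` is proved by induction on the largest variable `u` of an element of `P`
(`exists_characteristic_set`).  If `u` is not a leader, all coefficients with respect to `u` are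
in `P`.  If it is one of the chosen leaders, pseudo-division by its minimal relation applies.  If it
is a proper derivative of a chosen leader, the corresponding derivative of the relation is linear
in `u` with the separant as leading coefficient, and pseudo-division by it applies.
-/

namespace EqNoeth

open MvPolynomial

/-! ### Finitely determined sets -/

/-- The set `T` is finitely determined relative to the family `𝒬` of ideals if some finite subset
of `T` is contained in exactly the same members of `𝒬` as `T`. -/
def FinitelyDetermined {A : Type*} [CommRing A] (𝒬 : Set (Ideal A)) (T : Set A) : Prop :=
  ∃ F ⊆ T, F.Finite ∧ ∀ Q ∈ 𝒬, F ⊆ (Q : Set A) → T ⊆ Q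

/-- A set that is maximal among those that are not finitely determined is a prime ideal `P` closed
under the consequences of its finite subsets.  A finite `F ⊆ P` and `H ∉ P` as in the hypothesis
would make `P` finitely determined: by maximality `P ∪ {H}` is finitely determined, which covers the
members of `𝒬` that contain `H`, and `F` covers the others. -/
theorem finitelyDetermined_of_forall_prime {A : Type*} [CommRing A] {𝒬 : Set (Ideal A)}
    (h𝒬 : ∀ Q ∈ 𝒬, Q.IsPrime)
    (h : ∀ P : Ideal A, P.IsPrime →
      (∀ F ⊆ (P : Set A), F.Finite → ∀ f, (∀ Q ∈ 𝒬, F ⊆ (Q : Set A) → f ∈ Q) → f ∈ P) →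
      ∃ F ⊆ (P : Set A), F.Finite ∧ ∃ H ∉ P, ∀ Q ∈ 𝒬, F ⊆ (Q : Set A) → H ∉ Q → P ≤ Q)
    (T : Set A) : FinitelyDetermined 𝒬 T := by
  by_contra hT
  obtain ⟨M, -, hM⟩ := zorn_subset_nonempty {T | ¬ FinitelyDetermined 𝒬 T} (by
    rintro c hc hchain hne
    refine ⟨⋃₀ c, ?_, fun s hs => Set.subset_sUnion_of_mem hs⟩
    rintro ⟨F, hF, hfin, hQ⟩
    obtain ⟨s, hs, hFs⟩ := DirectedOn.exists_mem_subset_of_finite_of_subset_sUnion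
      hne hchain.directedOn hfin hF
    exact hc hs ⟨F, hFs, hfin, fun Q hQm hFQ =>
      (Set.subset_sUnion_of_mem hs).trans (hQ Q hQm hFQ)⟩) T hT
  have hMbad : ¬ FinitelyDetermined 𝒬 M := hM.prop
  -- Among the members of `𝒬` that contain a given `f ∉ M`, a finite subset of `M` determines `M`.
  have hins : ∀ f ∉ M, ∃ F ⊆ M, F.Finite ∧
      ∀ Q ∈ 𝒬, F ⊆ (Q : Set A) → f ∈ Q → M ⊆ (Q : Set A) := by
    intro f hf
    have hgood : FinitelyDetermined 𝒬 (insert f M) := by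
      by_contra hbad
      exact hf (hM.le_of_ge hbad (Set.subset_insert f M) (Set.mem_insert f M))
    obtain ⟨F, hF, hfin, hQ⟩ := hgood
    refine ⟨F \ {f}, fun x hx => (hF hx.1).resolve_left hx.2, hfin.sdiff, fun Q hQm hFQ hfQ => ?_⟩
    refine (Set.subset_insert f M).trans (hQ Q hQm fun x hx => ?_)
    by_cases hxf : x = f
    · exact hxf ▸ hfQ
    · exact hFQ ⟨hx, hxf⟩
  have hcons : ∀ F ⊆ M, F.Finite → ∀ f, (∀ Q ∈ 𝒬, F ⊆ (Q : Set A) → f ∈ Q) → f ∈ M := by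
    intro F hF hfin f hf
    by_contra hfM
    obtain ⟨G, hG, hGfin, hGQ⟩ := hins f hfM
    exact hMbad ⟨F ∪ G, Set.union_subset hF hG, hfin.union hGfin, fun Q hQ hFG =>
      hGQ Q hQ (Set.subset_union_right.trans hFG)
        (hf Q hQ (Set.subset_union_left.trans hFG))⟩
  let P : Ideal A :=
    { carrier := M
      add_mem' := fun {a b} ha hb => hcons {a, b} (Set.pair_subset ha hb) (Set.toFinite _) _
        fun Q _ hQ => Q.add_mem (hQ (by simp)) (hQ (by simp))
      zero_mem' := hcons ∅ (Set.empty_subset _) Set.finite_empty _ fun Q _ _ => Q.zero_mem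
      smul_mem' := fun c a ha => hcons {a} (Set.singleton_subset_iff.2 ha) (Set.toFinite _) _
        fun Q _ hQ => Q.mul_mem_left c (hQ (by simp)) }
  have hPprime : P.IsPrime := by
    refine ⟨fun htop => ?_, fun {f g} hfg => ?_⟩
    · have h1 : (1 : A) ∈ M := (Ideal.eq_top_iff_one P).1 htop
      exact hMbad ⟨{1}, Set.singleton_subset_iff.2 h1, Set.toFinite _, fun Q hQ h1Q =>
        absurd (h1Q rfl) ((Ideal.ne_top_iff_one Q).1 (h𝒬 Q hQ).ne_top)⟩
    · by_contra! hcon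
      obtain ⟨F, hF, hFfin, hFQ⟩ := hins f hcon.1
      obtain ⟨G, hG, hGfin, hGQ⟩ := hins g hcon.2
      refine hMbad ⟨insert (f * g) (F ∪ G), Set.insert_subset hfg (Set.union_subset hF hG),
        (hFfin.union hGfin).insert _, fun Q hQ hsub => ?_⟩
      obtain ⟨hfgQ, hFGQ⟩ := Set.insert_subset_iff.1 hsub
      rcases (h𝒬 Q hQ).mem_or_mem hfgQ with hf | hg
      · exact hFQ Q hQ (Set.subset_union_left.trans hFGQ) hf
      · exact hGQ Q hQ (Set.subset_union_right.trans hFGQ) hg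
  obtain ⟨F, hF, hFfin, H, hH, hQ⟩ := h P hPprime hcons
  obtain ⟨G, hG, hGfin, hGQ⟩ := hins H hH
  refine hMbad ⟨F ∪ G, Set.union_subset hF hG, hFfin.union hGfin, fun Q hQm hFG => ?_⟩
  by_cases hHQ : H ∈ Q
  · exact hGQ Q hQm (Set.subset_union_right.trans hFG) hHQ
  · exact hQ Q hQm (Set.subset_union_left.trans hFG) hHQ

theorem _root_.IsRadicallyNoetherian.finitelyDetermined {R : Type*} [CommRing R]
    (hR : IsRadicallyNoetherian R) (T : Set R) :
    FinitelyDetermined {q : Ideal R | q.IsPrime} T := by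
  let rad : Set R → {I : Ideal R // I.IsRadical} := fun F =>
    ⟨(Ideal.span F).radical, Ideal.radical_isRadical _⟩
  have hwf : WellFounded fun I J : {I : Ideal R // I.IsRadical} => I > J := hR.wf
  obtain ⟨_, ⟨F, ⟨hF, hfin⟩, rfl⟩, hmax⟩ := hwf.has_min (rad '' {F | F ⊆ T ∧ F.Finite})
    ⟨_, ∅, ⟨Set.empty_subset _, Set.finite_empty⟩, rfl⟩
  refine ⟨F, hF, hfin, fun q hq hFq t ht => ?_⟩
  have hle : rad F ≤ rad (insert t F) :=
    Ideal.radical_mono (Ideal.span_mono (Set.subset_insert t F))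
  have hge : rad (insert t F) ≤ rad F := by
    by_contra hcon
    exact hmax _ ⟨insert t F, ⟨Set.insert_subset ht hF, hfin.insert t⟩, rfl⟩
      (lt_of_le_not_ge hle hcon)
  have htF : t ∈ (Ideal.span F).radical :=
    hge (Ideal.le_radical (Ideal.subset_span (Set.mem_insert t F)))
  exact (Ideal.IsPrime.radical_le_iff hq).2 (Ideal.span_le.2 hFq) htF

/-! ### Pseudo-division modulo a pair of ideals -/

section PseudoDivision

open Polynomial

variable {R A : Type*} [CommRing R] [CommRing A] [Algebra R A] {B : Subalgebra R A} {x : A}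

theorem aeval_mem_of_forall_coeff_mem {Q : Ideal A} {g : B[X]} (h : ∀ i, (g.coeff i : A) ∈ Q) :
    aeval x g ∈ Q := by
  rw [Polynomial.aeval_eq_sum_range]
  refine Q.sum_mem fun i _ => ?_
  rw [Subalgebra.smul_def]
  exact Q.mul_mem_right _ (h i)

/-- Pseudo-division by `p`: if `p` has a leading coefficient outside the prime ideal `Q`, and all
relations of smaller degree have coefficients in `Q`, then every relation modulo `P` holds
modulo `Q`. -/
theorem aeval_mem_of_pseudoDivision {P Q : Ideal A} (hQ : Q.IsPrime) {p : B[X]}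
    (hpP : aeval x p ∈ P) (hpQ : aeval x p ∈ Q) (hd : 0 < p.natDegree)
    (hlc : (p.leadingCoeff : A) ∉ Q)
    (hlow : ∀ r : B[X], aeval x r ∈ P → r.natDegree < p.natDegree → ∀ i, (r.coeff i : A) ∈ Q)
    (g : B[X]) (hg : aeval x g ∈ P) : aeval x g ∈ Q := by
  induction hn : g.natDegree using Nat.strong_induction_on generalizing g with
  | _ n ih =>
  rcases lt_or_ge g.natDegree p.natDegree with hlt | hge
  · exact aeval_mem_of_forall_coeff_mem (hlow g hg hlt)
  set q : B[X] := Polynomial.C g.leadingCoeff * Polynomial.X ^ (g.natDegree - p.natDegree) * p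
    with hq
  set r : B[X] := Polynomial.C p.leadingCoeff * g - q with hr
  have hqdeg : q.natDegree ≤ g.natDegree := by
    refine Polynomial.natDegree_mul_le.trans ?_
    have := Polynomial.natDegree_C_mul_X_pow_le g.leadingCoeff (g.natDegree - p.natDegree)
    omega
  have hrdeg : r.natDegree < g.natDegree := by
    have hle : r.natDegree ≤ g.natDegree :=
      (Polynomial.natDegree_sub_le _ _).trans
        (max_le (Polynomial.natDegree_C_mul_le _ _) hqdeg)
    refine lt_of_le_of_ne hle fun heq => ?_
    have hc : r.coeff g.natDegree = 0 := by
      have hqc : q.coeff g.natDegree = g.leadingCoeff * p.leadingCoeff := by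
        have : q = Polynomial.C g.leadingCoeff * p *
            Polynomial.X ^ (g.natDegree - p.natDegree) := by rw [hq]; ring
        rw [this, Polynomial.coeff_mul_X_pow', if_pos (Nat.sub_le _ _), Nat.sub_sub_self hge,
          Polynomial.coeff_C_mul, Polynomial.coeff_natDegree]
      rw [hr, Polynomial.coeff_sub, Polynomial.coeff_C_mul, Polynomial.coeff_natDegree, hqc]
      ring
    rw [← heq, Polynomial.coeff_natDegree, Polynomial.leadingCoeff_eq_zero] at hc
    rw [hc, Polynomial.natDegree_zero] at heq
    omega
  have hrel : (p.leadingCoeff : A) * aeval x g = aeval x r +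
      aeval x (Polynomial.C g.leadingCoeff * Polynomial.X ^ (g.natDegree - p.natDegree)) *
        aeval x p := by
    rw [← map_mul, ← map_add, hr, hq, sub_add_cancel, map_mul, Polynomial.aeval_C]
    rfl
  have hrP : aeval x r ∈ P := by
    have : aeval x r = (p.leadingCoeff : A) * aeval x g -
      aeval x (Polynomial.C g.leadingCoeff * Polynomial.X ^ (g.natDegree - p.natDegree)) *
        aeval x p := eq_sub_of_add_eq hrel.symm
    rw [this]
    exact P.sub_mem (P.mul_mem_left _ hg) (P.mul_mem_left _ hpP)
  have hrQ := ih r.natDegree (hn ▸ hrdeg) r hrP rfl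
  refine (hQ.mem_or_mem (?_ : (p.leadingCoeff : A) * aeval x g ∈ Q)).resolve_left hlc
  rw [hrel]
  exact Q.add_mem hrQ (Q.mul_mem_left _ hpQ)

/-- If `x` satisfies over `B` a relation modulo `P` whose coefficients are not all in `P`, then in one
of minimal degree neither the leading coefficient nor the separant vanishes modulo `P`.  The
separant statement uses characteristic zero. -/
theorem exists_minimal_relation [Algebra ℚ R] {P : Ideal A}
    (h : ∃ p : B[X], aeval x p ∈ P ∧ ∃ i, (p.coeff i : A) ∉ P) :
    ∃ p : B[X], aeval x p ∈ P ∧ 0 < p.natDegree ∧ (p.leadingCoeff : A) ∉ P ∧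
      aeval x (derivative p) ∉ P ∧
      ∀ r : B[X], aeval x r ∈ P → r.natDegree < p.natDegree → ∀ i, (r.coeff i : A) ∈ P := by
  let S : Set B[X] := {p | aeval x p ∈ P ∧ ∃ i, (p.coeff i : A) ∉ P}
  obtain ⟨p, ⟨hpP, i, hi⟩, hmin⟩ := (measure (Polynomial.natDegree (R := B))).wf.has_min S h
  have hlow : ∀ r : B[X], aeval x r ∈ P → r.natDegree < p.natDegree →
      ∀ i, (r.coeff i : A) ∈ P := by
    intro r hr hdeg
    by_contra! hcon
    exact hmin r ⟨hr, hcon⟩ hdeg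
  have hd : 0 < p.natDegree := by
    by_contra hcon
    have h0 : p.natDegree = 0 := by omega
    rw [Polynomial.eq_C_of_natDegree_eq_zero h0, Polynomial.aeval_C] at hpP
    rcases Nat.eq_zero_or_pos i with rfl | hpos
    · exact hi hpP
    · rw [Polynomial.coeff_eq_zero_of_natDegree_lt (by omega)] at hi
      exact hi P.zero_mem
  have hlc : (p.leadingCoeff : A) ∉ P := by
    intro hlc
    have hlead : aeval x (Polynomial.monomial p.natDegree p.leadingCoeff) ∈ P := by
      rw [Polynomial.aeval_monomial]
      exact P.mul_mem_right _ hlc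
    have herase : aeval x p.eraseLead ∈ P := by
      rw [← Polynomial.self_sub_monomial_natDegree_leadingCoeff, map_sub]
      exact P.sub_mem hpP hlead
    have hdeg : p.eraseLead.natDegree < p.natDegree :=
      (Polynomial.eraseLead_natDegree_le p).trans_lt (by omega)
    by_cases hin : i = p.natDegree
    · exact hi (hin ▸ hlc)
    · exact hi (Polynomial.eraseLead_coeff_of_ne i hin ▸ hlow _ herase hdeg i)
  refine ⟨p, hpP, hd, hlc, fun hder => ?_, hlow⟩
  have hcoeff := hlow _ hder (Polynomial.natDegree_derivative_lt hd.ne') (p.natDegree - 1)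
  rw [Polynomial.coeff_derivative, Nat.sub_add_cancel hd] at hcoeff
  -- In characteristic zero the factor `p.natDegree` of the leading coefficient is invertible.
  have hinv : algebraMap R A (algebraMap ℚ R (p.natDegree : ℚ)⁻¹) * (p.natDegree : A) = 1 := by
    rw [← map_natCast (algebraMap R A) p.natDegree, ← map_natCast (algebraMap ℚ R) p.natDegree,
      ← map_mul, ← map_mul, inv_mul_cancel₀ (by exact_mod_cast hd.ne'), map_one, map_one]
  refine hlc ?_
  have hcast : ((p.coeff p.natDegree * (((p.natDegree - 1 : ℕ) : B) + 1) : B) : A) =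
      (p.leadingCoeff : A) * (p.natDegree : A) := by
    rw [← Nat.cast_succ, Nat.succ_eq_add_one, Nat.sub_add_cancel hd]
    simp
  rw [hcast] at hcoeff
  have := P.mul_mem_left (algebraMap R A (algebraMap ℚ R (p.natDegree : ℚ)⁻¹)) hcoeff
  rwa [mul_left_comm, hinv, mul_one] at this

end PseudoDivision

/-! ### Differential polynomials -/

section DifferentialPolynomials

variable {R : Type*} [CommRing R] {V ι : Type*}

/-- The derivation of the polynomial ring in the variables `V` that maps every variable `u` to the
variable `shift j u` and vanishes on the coefficients. -/
noncomputable def shiftDerivation (R : Type*) [CommRing R] (shift : ι → V → V) (j : ι) :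
    Derivation R (MvPolynomial V R) (MvPolynomial V R) :=
  mkDerivation R fun u => X (shift j u)

/-- The prime ideals that are stable under all derivations `shiftDerivation R shift j`. -/
def primeDifferentialIdeals (R : Type*) [CommRing R] (shift : ι → V → V) :
    Set (Ideal (MvPolynomial V R)) :=
  {Q | Q.IsPrime ∧ ∀ j, ∀ f ∈ Q, shiftDerivation R shift j f ∈ Q}

variable {shift : ι → V → V}

theorem shiftDerivation_X (j : ι) (u : V) :
    shiftDerivation R shift j (X u) = X (shift j u) :=
  mkDerivation_X R _ u

theorem shiftDerivation_mem_supported {s t : Set V} (j : ι) (hst : s ⊆ t)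
    (hshift : ∀ u ∈ s, shift j u ∈ t) {f : MvPolynomial V R} (hf : f ∈ supported R s) :
    shiftDerivation R shift j f ∈ supported R t := by
  rw [supported_eq_adjoin_X] at hf
  induction hf using Algebra.adjoin_induction with
  | mem f hf =>
    obtain ⟨u, hu, rfl⟩ := hf
    rw [shiftDerivation_X]
    exact Algebra.subset_adjoin ⟨_, hshift u hu, rfl⟩
  | algebraMap r => rw [Derivation.map_algebraMap]; exact zero_mem _
  | add f g _ _ hf hg => rw [map_add]; exact add_mem hf hg
  | mul f g hf' hg' hf hg =>
    rw [Derivation.leibniz, smul_eq_mul, smul_eq_mul]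
    exact add_mem (mul_mem (supported_mono hst hf') hg) (mul_mem (supported_mono hst hg') hf)


theorem X_mem_supported_of_mem {t : Set V} {u : V} (h : u ∈ t) :
    (X u : MvPolynomial V R) ∈ supported R t :=
  Algebra.subset_adjoin ⟨u, h, rfl⟩

variable [LinearOrder V]

theorem aeval_X_mem_supported {t : Set V} {u : V} (hlt : Set.Iio u ⊆ t) (hu : u ∈ t)
    (p : Polynomial (supported R (Set.Iio u))) :
    Polynomial.aeval (X u : MvPolynomial V R) p ∈ supported R t := by
  rw [Polynomial.aeval_eq_sum_range]
  refine sum_mem fun i _ => ?_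
  rw [Subalgebra.smul_def]
  exact mul_mem (supported_mono hlt (p.coeff i).2)
    (pow_mem (X_mem_supported_of_mem hu) _)

/-- Polynomials in the variables up to `u` are polynomials in `u` over the smaller variables. -/
theorem exists_aeval_X_eq {u : V} {f : MvPolynomial V R} (hf : f ∈ supported R (Set.Iic u)) :
    ∃ p : Polynomial (supported R (Set.Iio u)), Polynomial.aeval (X u : MvPolynomial V R) p = f := by
  suffices h : supported R (Set.Iic u) ≤
      (((Polynomial.aeval (X u : MvPolynomial V R) :
        Polynomial (supported R (Set.Iio u)) →ₐ[_] _)).restrictScalars R).range from h hf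
  refine Algebra.adjoin_le ?_
  rintro _ ⟨w, hw, rfl⟩
  rw [SetLike.mem_coe, AlgHom.mem_range]
  rcases (Set.mem_Iic.1 hw).lt_or_eq with hlt | rfl
  · refine ⟨Polynomial.C ⟨X w, X_mem_supported_of_mem hlt⟩, ?_⟩
    exact Polynomial.aeval_C _ _
  · exact ⟨Polynomial.X, Polynomial.aeval_X _⟩

theorem mem_supported_Iic_or_mem_range_C (f : MvPolynomial V R) :
    (∃ r, f = C r) ∨ ∃ u ∈ f.vars, f ∈ supported R (Set.Iic u) := by
  rcases f.vars.eq_empty_or_nonempty with h | h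
  · have hf : f ∈ supported R (∅ : Set V) := mem_supported.2 (by simp [h])
    rw [supported_empty, Algebra.mem_bot] at hf
    exact Or.inl (hf.imp fun r hr => hr.symm)
  · exact Or.inr ⟨f.vars.max' h, f.vars.max'_mem h,
      mem_supported.2 fun w hw => f.vars.le_max' w hw⟩

/-- The derivative of a polynomial with leader `u` is linear in the derivative of `u`, with the
separant as leading coefficient. -/
theorem shiftDerivation_aeval_X_sub_mem {u : V} (hmono : ∀ j, StrictMono (shift j))
    (hlt : ∀ j w, w < shift j w) (j : ι) (p : Polynomial (supported R (Set.Iio u))) :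
    shiftDerivation R shift j (Polynomial.aeval (X u) p) -
      Polynomial.aeval (X u) (Polynomial.derivative p) * X (shift j u) ∈
        supported R (Set.Iio (shift j u)) := by
  induction p using Polynomial.induction_on' with
  | add p q hp hq =>
    simp only [map_add, add_mul]
    rw [add_sub_add_comm]
    exact add_mem hp hq
  | monomial n c =>
    have key : shiftDerivation R shift j (Polynomial.aeval (X u) (Polynomial.monomial n c)) -
        Polynomial.aeval (X u) (Polynomial.derivative (Polynomial.monomial n c)) *
          X (shift j u) = X u ^ n * shiftDerivation R shift j (c : MvPolynomial V R) := by
      rw [Polynomial.derivative_monomial, Polynomial.aeval_monomial, Polynomial.aeval_monomial,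
        Derivation.leibniz, Derivation.leibniz_pow, shiftDerivation_X]
      simp only [smul_eq_mul, nsmul_eq_mul, map_mul, map_natCast]
      have hc : algebraMap (supported R (Set.Iio u)) (MvPolynomial V R) c = c := rfl
      rw [hc]
      ring
    rw [key]
    refine mul_mem (pow_mem (X_mem_supported_of_mem (t := Set.Iio (shift j u)) (hlt j u)) n)
      (shiftDerivation_mem_supported j (Set.Iio_subset_Iio (hlt j u).le) (fun w hw => ?_) c.2)
    exact hmono j (Set.mem_Iio.1 hw)

/-- Every proper derivative of a relation with leader `u` is linear in the corresponding derivative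
`w` of `u`, and its leading coefficient is the separant of the relation. -/
theorem exists_separant_mul_X_add_mem {u w : V} (hmono : ∀ j, StrictMono (shift j))
    (hlt : ∀ j w, w < shift j w) {I : Ideal (MvPolynomial V R)}
    (hI : ∀ j, ∀ f ∈ I, shiftDerivation R shift j f ∈ I)
    {p : Polynomial (supported R (Set.Iio u))} (hp : Polynomial.aeval (X u) p ∈ I)
    (hw : Relation.TransGen (fun a b => ∃ j, b = shift j a) u w) :
    u < w ∧ ∃ t ∈ supported R (Set.Iio w),
      Polynomial.aeval (X u) (Polynomial.derivative p) * X w + t ∈ I := by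
  induction hw with
  | single h =>
    obtain ⟨j, rfl⟩ := h
    refine ⟨hlt j u, _, shiftDerivation_aeval_X_sub_mem hmono hlt j p, ?_⟩
    rw [add_sub_cancel]
    exact hI j _ hp
  | @tail w _ _ h ih =>
    obtain ⟨j, rfl⟩ := h
    obtain ⟨huw, t, ht, hmem⟩ := ih
    have hs : shiftDerivation R shift j (Polynomial.aeval (X u) (Polynomial.derivative p)) ∈
        supported R (Set.Iio (shift j w)) := by
      refine shiftDerivation_mem_supported (s := Set.Iic u) j (fun v hv => ?_) (fun v hv => ?_)
        (aeval_X_mem_supported Set.Iio_subset_Iic_self Set.self_mem_Iic _)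
      · exact ((Set.mem_Iic.1 hv).trans_lt huw).trans (hlt j w)
      · exact hmono j ((Set.mem_Iic.1 hv).trans_lt huw)
    have ht' : shiftDerivation R shift j t ∈ supported R (Set.Iio (shift j w)) :=
      shiftDerivation_mem_supported j (Set.Iio_subset_Iio (hlt j w).le)
        (fun v hv => hmono j (Set.mem_Iio.1 hv)) ht
    refine ⟨huw.trans (hlt j w), _,
      add_mem (mul_mem (X_mem_supported_of_mem (hlt j w)) hs) ht', ?_⟩
    have := hI j _ hmem
    rwa [map_add, Derivation.leibniz, shiftDerivation_X, smul_eq_mul, smul_eq_mul,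
      add_assoc] at this

/-- The variable `u` is a leader of `P` if `P` contains a polynomial in the variables up to `u`
that, as a polynomial in `u`, does not have all its coefficients in `P`.  For a prime ideal `P` this
means that `u` is algebraic modulo `P` over the smaller variables. -/
def IsLeader (P : Ideal (MvPolynomial V R)) (u : V) : Prop :=
  ∃ p : Polynomial (supported R (Set.Iio u)),
    Polynomial.aeval (X u) p ∈ P ∧ ∃ i, (p.coeff i : MvPolynomial V R) ∉ P

/-- A prime differential ideal `P` is determined, away from the zeros of some `H ∉ P`, by finitely many
of its elements.  The hypothesis `hfin` is the conclusion of Dickson's lemma. -/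
theorem exists_characteristic_set [Algebra ℚ R] [WellFoundedLT V]
    (hR : IsRadicallyNoetherian R) (hmono : ∀ j, StrictMono (shift j))
    (hlt : ∀ j w, w < shift j w)
    (hfin : ∀ Λ : Set V, ∃ F ⊆ Λ, F.Finite ∧
      ∀ u ∈ Λ, ∃ v ∈ F, Relation.ReflTransGen (fun a b => ∃ j, b = shift j a) v u)
    {P : Ideal (MvPolynomial V R)} (hP : P ∈ primeDifferentialIdeals R shift) :
    ∃ F ⊆ (P : Set (MvPolynomial V R)), F.Finite ∧ ∃ H ∉ P,
      ∀ Q ∈ primeDifferentialIdeals R shift, F ⊆ (Q : Set (MvPolynomial V R)) → H ∉ Q → P ≤ Q := by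
  obtain ⟨hPprime, hPD⟩ := hP
  obtain ⟨F₀, hF₀P, hF₀fin, hF₀⟩ := hR.finitelyDetermined {r : R | C r ∈ P}
  obtain ⟨Λ, hΛ, hΛfin, hΛmin⟩ := hfin {u | IsLeader P u}
  -- `Λ` is the finite set of leaders of which all others are derivatives; `p v` is a relation of
  -- minimal degree for `v`.
  choose! p hpP hpdeg hplc hpder hplow using
    fun (u : V) (hu : IsLeader P u) => exists_minimal_relation hu
  refine ⟨C '' F₀ ∪ (fun v => Polynomial.aeval (X v) (p v)) '' Λ, ?_,
    (hF₀fin.image _).union (hΛfin.image _), ∏ v ∈ hΛfin.toFinset,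
      ((p v).leadingCoeff : MvPolynomial V R) *
        Polynomial.aeval (X v) (Polynomial.derivative (p v)), ?_, ?_⟩
  · rintro _ (⟨r, hr, rfl⟩ | ⟨v, hv, rfl⟩)
    · exact hF₀P hr
    · exact hpP v (hΛ hv)
  · intro hmem
    obtain ⟨v, hv, hvP⟩ := (hPprime.prod_mem_iff).1 hmem
    have hv' := hΛ (hΛfin.mem_toFinset.1 hv)
    exact (hPprime.mem_or_mem hvP).elim (hplc v hv') (hpder v hv')
  rintro Q ⟨hQprime, hQD⟩ hFQ hHQ
  have hHfac : ∀ v ∈ Λ, ((p v).leadingCoeff : MvPolynomial V R) ∉ Q ∧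
      Polynomial.aeval (X v) (Polynomial.derivative (p v)) ∉ Q := fun v hv =>
    have hv' : v ∈ hΛfin.toFinset := hΛfin.mem_toFinset.2 hv
    ⟨fun h => hHQ (Q.prod_mem hv' (Q.mul_mem_right _ h)),
      fun h => hHQ (Q.prod_mem hv' (Q.mul_mem_left _ h))⟩
  have hpQ : ∀ v ∈ Λ, Polynomial.aeval (X v) (p v) ∈ Q := fun v hv =>
    hFQ (Or.inr ⟨v, hv, rfl⟩)
  have hconst : ∀ r, C r ∈ P → C r ∈ Q := fun r hr =>
    hF₀ (Q.comap C) (hQprime.comap C) (fun r hr => hFQ (Or.inl ⟨r, hr, rfl⟩)) hr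
  have main : ∀ u, ∀ f ∈ supported R (Set.Iic u), f ∈ P → f ∈ Q := by
    intro u
    induction u using WellFoundedLT.induction with
    | _ u ih =>
    have hbelow : ∀ f ∈ supported R (Set.Iio u), f ∈ P → f ∈ Q := by
      intro f hf hfP
      rcases mem_supported_Iic_or_mem_range_C f with ⟨r, rfl⟩ | ⟨w, hw, hfw⟩
      · exact hconst r hfP
      · exact ih w (mem_supported.1 hf hw) f hfw hfP
    intro f hf hfP
    obtain ⟨g, rfl⟩ := exists_aeval_X_eq hf
    by_cases hu : IsLeader P u
    · obtain ⟨v, hv, hvu⟩ := hΛmin u hu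
      rcases Relation.reflTransGen_iff_eq_or_transGen.1 hvu with rfl | hvu
      · exact aeval_mem_of_pseudoDivision hQprime (hpP _ hu) (hpQ _ hv) (hpdeg _ hu)
          (hHfac _ hv).1 (fun r hr hdeg i => hbelow _ (r.coeff i).2 (hplow _ hu r hr hdeg i)) g hfP
      -- The derivative of `p v` with leader `u` is linear in `u`; it lies in both `P` and `Q`.
      · obtain ⟨hvlt, t, ht, hmem⟩ := exists_separant_mul_X_add_mem hmono hlt (I := P ⊓ Q)
          (fun j f hf => ⟨hPD j f hf.1, hQD j f hf.2⟩) ⟨hpP v (hΛ hv), hpQ v hv⟩ hvu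
        have hs : Polynomial.aeval (X v) (Polynomial.derivative (p v)) ∈
            supported R (Set.Iio u) :=
          aeval_X_mem_supported (Set.Iio_subset_Iio hvlt.le) hvlt _
        have hs0 : (⟨_, hs⟩ : supported R (Set.Iio u)) ≠ 0 := fun h0 =>
          (hHfac v hv).2 (by rw [show Polynomial.aeval (X v) (Polynomial.derivative (p v)) =
            (0 : MvPolynomial V R) from congrArg Subtype.val h0]; exact Q.zero_mem)
        have heval : Polynomial.aeval (X u : MvPolynomial V R)
            (Polynomial.C (⟨_, hs⟩ : supported R (Set.Iio u)) * Polynomial.X +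
              Polynomial.C ⟨t, ht⟩) =
            Polynomial.aeval (X v) (Polynomial.derivative (p v)) * X u + t := by
          rw [map_add, map_mul, Polynomial.aeval_C, Polynomial.aeval_C, Polynomial.aeval_X]
          rfl
        have hdeg := Polynomial.natDegree_linear (b := (⟨t, ht⟩ : supported R (Set.Iio u))) hs0
        refine aeval_mem_of_pseudoDivision hQprime (heval ▸ hmem.1) (heval ▸ hmem.2)
          (by rw [hdeg]; exact Nat.one_pos)
          (by rw [Polynomial.leadingCoeff_linear hs0]; exact (hHfac v hv).2)
          (fun r hr hrdeg i => ?_) g hfP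
        rw [hdeg, Nat.lt_one_iff] at hrdeg
        rw [Polynomial.eq_C_of_natDegree_eq_zero hrdeg, Polynomial.aeval_C] at hr
        rcases Nat.eq_zero_or_pos i with rfl | hi
        · exact hbelow _ (r.coeff 0).2 hr
        · rw [Polynomial.coeff_eq_zero_of_natDegree_lt (by omega)]
          exact Q.zero_mem
    · refine aeval_mem_of_forall_coeff_mem fun i => hbelow _ (g.coeff i).2 ?_
      by_contra hi
      exact hu ⟨g, hfP, i, hi⟩
  intro f hf
  rcases mem_supported_Iic_or_mem_range_C f with ⟨r, rfl⟩ | ⟨u, -, hfu⟩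
  · exact hconst r hf
  · exact main u f hfu hf

/-- A form of the Ritt–Raudenbush basis theorem. -/
theorem finitelyDetermined_primeDifferentialIdeals [Algebra ℚ R] [WellFoundedLT V]
    (hR : IsRadicallyNoetherian R) (hmono : ∀ j, StrictMono (shift j))
    (hlt : ∀ j w, w < shift j w)
    (hfin : ∀ Λ : Set V, ∃ F ⊆ Λ, F.Finite ∧
      ∀ u ∈ Λ, ∃ v ∈ F, Relation.ReflTransGen (fun a b => ∃ j, b = shift j a) v u)
    (T : Set (MvPolynomial V R)) :
    FinitelyDetermined (primeDifferentialIdeals R shift) T := by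
  refine finitelyDetermined_of_forall_prime (fun Q hQ => hQ.1) (fun P hP hcons => ?_) T
  refine exists_characteristic_set hR hmono hlt hfin ⟨hP, fun j f hf => ?_⟩
  exact hcons {f} (Set.singleton_subset_iff.2 hf) (Set.toFinite _) _
    fun Q hQ hfQ => hQ.2 j f (hfQ rfl)

end DifferentialPolynomials

/-! ### Jet variables and their evaluation -/

section Jets

/-- The jet variables: the pair of a multi-index `α` and `k` stands for the derivative `δ^α` of the
`k`-th unknown.  They are ordered lexicographically, first by `α`, then by `k`. -/
abbrev JetVar (m : ℕ) (κ : Type*) : Type _ := Lex (Fin m →₀ ℕ) ×ₗ κ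

variable {m : ℕ} {κ : Type*}

/-- The jet variable that stands for the derivative by `δ j` of the jet variable `v`. -/
noncomputable def JetVar.raise (j : Fin m) (v : JetVar m κ) : JetVar m κ :=
  toLex ((ofLex v).1 + toLex (Finsupp.single j 1), (ofLex v).2)

theorem JetVar.raise_strictMono [LinearOrder κ] (j : Fin m) :
    StrictMono (JetVar.raise j : JetVar m κ → JetVar m κ) := by
  intro v w hvw
  rw [Prod.Lex.lt_iff] at hvw ⊢
  exact hvw.imp (fun h => add_lt_add_left h _) fun h => ⟨congrArg (· + _) h.1, h.2⟩

theorem JetVar.lt_raise [LinearOrder κ] (j : Fin m) (v : JetVar m κ) : v < JetVar.raise j v := by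
  refine Prod.Lex.lt_iff.2 (Or.inl ?_)
  refine lt_add_of_pos_right _ (Finsupp.toLex_monotone.strictMono_of_injective
    toLex.injective ?_ : (toLex (0 : Fin m →₀ ℕ)) < toLex (Finsupp.single j 1))
  exact (zero_le (a := Finsupp.single j 1)).lt_of_ne (by simp [eq_comm])

theorem JetVar.reflTransGen_raise (k : κ) (β α : Fin m →₀ ℕ) :
    Relation.ReflTransGen (fun a b : JetVar m κ => ∃ j, b = JetVar.raise j a)
      (toLex (toLex α, k)) (toLex (toLex (α + β), k)) := by
  induction β using Finsupp.induction_linear generalizing α with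
  | zero => rw [add_zero]
  | add β γ hβ hγ => rw [← add_assoc]; exact (hβ α).trans (hγ _)
  | single j n =>
    induction n with
    | zero => rw [Finsupp.single_zero, add_zero]
    | succ n ih =>
      refine ih.tail ⟨j, ?_⟩
      rw [Finsupp.single_add, ← add_assoc]
      rfl

/-- Dickson's lemma for the jet variables. -/
theorem JetVar.exists_finite_generating [Finite κ] (Λ : Set (JetVar m κ)) :
    ∃ F ⊆ Λ, F.Finite ∧ ∀ u ∈ Λ, ∃ v ∈ F,
      Relation.ReflTransGen (fun a b => ∃ j, b = JetVar.raise j a) v u := by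
  let S : κ → Set (Fin m →₀ ℕ) := fun k => {α | toLex (toLex α, k) ∈ Λ}
  refine ⟨⋃ k, (fun α => toLex (toLex α, k)) '' {α | Minimal (· ∈ S k) α}, ?_, ?_, ?_⟩
  · rintro _ h
    obtain ⟨k, α, hα, rfl⟩ := Set.mem_iUnion.1 h
    exact hα.prop
  · exact Set.finite_iUnion fun k =>
      (WellQuasiOrderedLE.finite_of_isAntichain (setOfPred_minimal_antichain _)).image _
  · intro u hu
    obtain ⟨α, hα, hmin⟩ := exists_minimal_le_of_wellFoundedLT (· ∈ S (ofLex u).2)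
      (ofLex (ofLex u).1) hu
    obtain ⟨β, hβ⟩ := exists_add_of_le hα
    refine ⟨_, Set.mem_iUnion.2 ⟨(ofLex u).2, α, hmin, rfl⟩, ?_⟩
    have := JetVar.reflTransGen_raise (ofLex u).2 β α
    rwa [← hβ] at this

variable {R A : Type*} [CommRing R] [CommRing A] [Algebra R A] (D : DifferentialStructure R A m)

/-- The derivative `δ^α a`. -/
noncomputable def DifferentialStructure.iterate (α : Fin m →₀ ℕ) (a : A) : A :=
  haveI : LeftCommutative fun (j : Fin m) (b : A) => D.δ j b := ⟨D.comm⟩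
  (Finsupp.toMultiset α).foldr (fun j b => D.δ j b) a

theorem DifferentialStructure.iterate_zero (a : A) : D.iterate 0 a = a := by
  simp [iterate]

theorem DifferentialStructure.iterate_add_single (α : Fin m →₀ ℕ) (j : Fin m) (a : A) :
    D.iterate (α + Finsupp.single j 1) a = D.δ j (D.iterate α a) := by
  have : LeftCommutative fun (j : Fin m) (b : A) => D.δ j b := ⟨D.comm⟩
  have h : Finsupp.toMultiset (α + Finsupp.single j 1) = j ::ₘ Finsupp.toMultiset α := by
    rw [Finsupp.toMultiset_add, Finsupp.toMultiset_single, one_smul, add_comm]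
    rfl
  rw [iterate, h, Multiset.foldr_cons, iterate]

/-- The value of a differential polynomial in the unknowns `κ` at the point `y`. -/
noncomputable def jetEval (y : κ → A) : MvPolynomial (JetVar m κ) R →ₐ[R] A :=
  aeval fun v => D.iterate (ofLex (ofLex v).1) (y (ofLex v).2)

theorem jetEval_shiftDerivation (y : κ → A) (j : Fin m) (f : MvPolynomial (JetVar m κ) R) :
    jetEval D y (shiftDerivation R JetVar.raise j f) = D.δ j (jetEval D y f) := by
  induction f using MvPolynomial.induction_on with
  | C r =>
    rw [← algebraMap_eq, Derivation.map_algebraMap, AlgHom.commutes, Derivation.map_algebraMap,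
      map_zero]
  | add f g hf hg => simp only [map_add, hf, hg]
  | mul_X f v hf =>
    have hX : jetEval D y (X (JetVar.raise j v) : MvPolynomial (JetVar m κ) R) =
        D.δ j (jetEval D y (X v)) := by
      rw [jetEval, aeval_X, aeval_X]
      exact D.iterate_add_single _ j _
    simp only [Derivation.leibniz, smul_eq_mul, map_add, map_mul, hf, shiftDerivation_X, hX]

theorem ker_jetEval_mem_primeDifferentialIdeals [IsDomain A] (y : κ → A) :
    RingHom.ker (jetEval D y) ∈
      primeDifferentialIdeals R (JetVar.raise : Fin m → JetVar m κ → JetVar m κ) := by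
  refine ⟨RingHom.ker_isPrime _, fun j f hf => ?_⟩
  rw [RingHom.mem_ker] at hf ⊢
  rw [jetEval_shiftDerivation, hf, map_zero]

/-- Given a set `Y` whose points `x` have coordinates `y x`, the algebra of the functions on `Y`
that are given by differential polynomials in the coordinates. -/
noncomputable def jetFunctions {Y : Type*} (y : Y → κ → A) : Subalgebra R (Y → A) :=
  (AlgHom.pi (A := fun _ : Y => A) fun x => jetEval D (y x)).range

variable {D} {Y : Type*} {y : Y → κ → A}

theorem mem_jetFunctions {φ : Y → A} :
    φ ∈ jetFunctions D y ↔ ∃ f, ∀ x, φ x = jetEval D (y x) f := by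
  refine exists_congr fun f => ?_
  rw [funext_iff]
  exact forall_congr' fun x => eq_comm

theorem coord_mem_jetFunctions (k : κ) : (fun x => y x k) ∈ jetFunctions D y :=
  mem_jetFunctions.2 ⟨X (toLex (toLex 0, k)), fun x => by
    rw [jetEval, aeval_X]
    exact (D.iterate_zero _).symm⟩

theorem deriv_mem_jetFunctions (j : Fin m) {φ : Y → A} (hφ : φ ∈ jetFunctions D y) :
    (fun x => D.δ j (φ x)) ∈ jetFunctions D y := by
  obtain ⟨f, hf⟩ := mem_jetFunctions.1 hφ
  exact mem_jetFunctions.2 ⟨shiftDerivation R JetVar.raise j f, fun x => by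
    rw [jetEval_shiftDerivation, hf]⟩

/-- Every system of algebraic differential equations is equivalent to a finite subsystem. -/
theorem exists_finite_subset_jetFunctions [IsDomain A] [Algebra ℚ R] [Finite κ]
    (hR : IsRadicallyNoetherian R) {T : Set (Y → A)} (hT : T ⊆ jetFunctions D y) :
    ∃ F ⊆ T, F.Finite ∧ ∀ x, (∀ φ ∈ F, φ x = 0) → ∀ φ ∈ T, φ x = 0 := by
  let : LinearOrder κ := IsWellOrder.linearOrder WellOrderingRel
  have : WellFoundedLT (Lex (Fin m →₀ ℕ)) := Finsupp.Lex.wellFoundedLT_of_finite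
  have hex : ∀ φ ∈ T, ∃ f : MvPolynomial (JetVar m κ) R, ∀ x, φ x = jetEval D (y x) f :=
    fun φ hφ => mem_jetFunctions.1 (hT hφ)
  choose! f hf using hex
  obtain ⟨G, hG, hGfin, hGT⟩ := finitelyDetermined_primeDifferentialIdeals
    (shift := (JetVar.raise : Fin m → JetVar m κ → JetVar m κ)) hR
    JetVar.raise_strictMono JetVar.lt_raise JetVar.exists_finite_generating (f '' T)
  obtain ⟨F, hF, hFfin, rfl⟩ := hGfin.exists_subset_finite_image_eq hG
  refine ⟨F, hF, hFfin, fun x hx φ hφ => ?_⟩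
  have h := hGT _ (ker_jetEval_mem_primeDifferentialIdeals D (y x)) (by
    rintro _ ⟨ψ, hψ, rfl⟩
    rw [SetLike.mem_coe, RingHom.mem_ker, ← hf ψ (hF hψ), hx ψ hψ])
  have := h ⟨φ, hφ, rfl⟩
  rwa [SetLike.mem_coe, RingHom.mem_ker, ← hf φ hφ] at this

end Jets

/-! ### Equations over a nonassociative algebra -/

section Equations

variable {R : Type*} [CommRing R] {M : AlgVariety R} {B : Type*} [NonUnitalNonAssocRing B]
  [Module R B] [IsScalarTower R B B] [SMulCommClass R B B]

theorem noetherianSpace_zariskiTopology (hB : M.Contains B) (n : ℕ)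
    (h : ∀ T : Set (EquationAlgebra M B n), ∃ F ⊆ T, F.Finite ∧ zeroSet hB F ⊆ zeroSet hB T) :
    @TopologicalSpace.NoetherianSpace (Fin n → B) (zariskiTopology hB n) := by
  let := zariskiTopology hB n
  refine TopologicalSpace.noetherianSpace_iff_isCompact.2 fun s => ?_
  -- By Alexander's theorem it suffices to consider covers by complements of sets `Z(S)`.
  refine isCompact_generateFrom rfl fun P hP hs => ?_
  have hP' : ∀ U ∈ P, ∃ S : Set (EquationAlgebra M B n), U = (zeroSet hB S)ᶜ := fun U hU => hP hU
  choose! S hS using hP'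
  obtain ⟨F, hF, hFfin, hFT⟩ := h (⋃ U ∈ P, S U)
  have hF' : ∀ f ∈ F, ∃ U ∈ P, f ∈ S U := fun f hf => by simpa using hF hf
  choose! U hUP hfU using hF'
  refine ⟨U '' F, Set.image_subset_iff.2 hUP, hFfin.image U, fun a ha => ?_⟩
  by_contra hcon
  have haF : a ∈ zeroSet hB F := by
    intro f hf
    by_contra hne
    refine hcon ⟨U f, ⟨f, hf, rfl⟩, ?_⟩
    rw [hS _ (hUP f hf)]
    exact fun hz => hne (hz f (hfU f hf))
  obtain ⟨W, hW, haW⟩ := hs ha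
  rw [hS W hW] at haW
  exact haW fun f hf => hFT haF f (Set.mem_biUnion hW hf)

/-- The value of a function that belongs to an algebra of functions, as a homomorphism. -/
def evalHom {Y : Type*} (Φ : NonUnitalSubalgebra R (Y → B)) (x : Y) : Φ →ₙₐ[R] B where
  toFun φ := φ.1 x
  map_smul' _ _ := rfl
  map_zero' := rfl
  map_add' _ _ := rfl
  map_mul' _ _ := rfl

/-- Algebras of `B`-valued functions belong to every variety that contains `B`. -/
theorem contains_of_functions {Y : Type*} (hB : M.Contains B)
    (Φ : NonUnitalSubalgebra R (Y → B)) : M.Contains Φ := by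
  intro p hp v
  refine Subtype.ext (funext fun x => ?_)
  have h : (evalHom Φ x).comp (FreeNonUnitalNonAssocAlgebra.lift R v) =
      FreeNonUnitalNonAssocAlgebra.lift R fun i => evalHom Φ x (v i) := by
    refine FreeNonUnitalNonAssocAlgebra.hom_ext R fun i => ?_
    rw [NonUnitalAlgHom.comp_apply, FreeNonUnitalNonAssocAlgebra.lift_of_apply,
      FreeNonUnitalNonAssocAlgebra.lift_of_apply]
  exact (NonUnitalAlgHom.congr_fun h p).trans (hB p hp _)

/-- The functions `a ↦ f(a)` belong to every algebra of functions that contains the constants and the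
coordinates: such an algebra belongs to the variety, so that `f` has a value in it at the
coordinates. -/
theorem evalAt_mem_of_const_mem_of_coord_mem (hB : M.Contains B) {n : ℕ}
    (Φ : NonUnitalSubalgebra R ((Fin n → B) → B)) (hconst : ∀ b, (fun _ => b) ∈ Φ)
    (hcoord : ∀ i, (fun a => a i) ∈ Φ) (f : EquationAlgebra M B n) :
    (fun a => evalAt hB a f) ∈ Φ := by
  have hΦ := contains_of_functions hB Φ
  let const : B →ₙₐ[R] Φ :=
    { toFun := fun b => ⟨fun _ => b, hconst b⟩
      map_smul' := fun _ _ => rfl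
      map_zero' := rfl
      map_add' := fun _ _ => rfl
      map_mul' := fun _ _ => rfl }
  let ψ : M.Free (Fin n) →ₙₐ[R] Φ := AlgVariety.Free.lift hΦ fun i => ⟨fun a => a i, hcoord i⟩
  let χ : EquationAlgebra M B n →ₙₐ[R] Φ := AlgVariety.Coprod.lift hΦ const ψ
  have hψ : ∀ a, (evalHom Φ a).comp ψ = AlgVariety.Free.lift hB a := fun a =>
    AlgVariety.Presented.hom_ext fun i =>
      (congrArg (evalHom Φ a) (AlgVariety.Presented.lift_gen hΦ _ (fun _ hr => hr.elim) i)).trans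
        (AlgVariety.Presented.lift_gen hB _ (fun _ hr => hr.elim) i).symm
  have hχ : ∀ a, (evalHom Φ a).comp χ = evalAt hB a := fun a => by
    refine AlgVariety.Presented.hom_ext ?_
    rintro (b | g)
    · exact (congrArg (evalHom Φ a) (AlgVariety.Coprod.lift_inl hΦ const ψ b)).trans
        (AlgVariety.Coprod.lift_inl hB (NonUnitalAlgHom.id R B) _ b).symm
    · exact ((congrArg (evalHom Φ a) (AlgVariety.Coprod.lift_inr hΦ const ψ g)).trans
        (NonUnitalAlgHom.congr_fun (hψ a) g)).trans
        (AlgVariety.Coprod.lift_inr hB (NonUnitalAlgHom.id R B) _ g).symm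
  have h : (fun a => evalAt hB a f) = (χ f).1 :=
    funext fun a => (NonUnitalAlgHom.congr_fun (hχ a) f).symm
  rw [h]
  exact (χ f).2

/-- An algebra `B` is equationally Noetherian if it embeds linearly into `Aᵐ`, for a finitely
generated differential domain `A` over `R`, so that the product of `B` is given by differential
polynomials.  The last condition is expressed by the closure of all algebras of functions that are
stable under the derivations. -/
theorem isEquationallyNoetherian_of_coordinates {A : Type*} [CommRing A] [IsDomain A]
    [Algebra R A] [Algebra ℚ R] [Algebra.FiniteType R A] (hR : IsRadicallyNoetherian R) {m : ℕ}
    (D : DifferentialStructure R A m) (e : B →ₗ[R] Fin m → A) (he : Function.Injective e)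
    (hmul : ∀ {n : ℕ} (Φ : Subalgebra R ((Fin n → B) → A)),
      (∀ j, ∀ φ ∈ Φ, (fun x => D.δ j (φ x)) ∈ Φ) →
      ∀ f g : (Fin n → B) → B, (∀ k, (fun x => e (f x) k) ∈ Φ) → (∀ k, (fun x => e (g x) k) ∈ Φ) →
        ∀ k, (fun x => e (f x * g x) k) ∈ Φ) :
    IsEquationallyNoetherian R B := by
  intro M hB n
  refine noetherianSpace_zariskiTopology hB n fun T => ?_
  obtain ⟨s, hs⟩ := Algebra.FiniteType.out (R := R) (A := A)
  -- The generators of `A` serve as additional unknowns, with fixed values, so that equations with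
  -- coefficients in `A` become differential polynomials over the ring `R` of constants.
  let y : (Fin n → B) → s ⊕ Fin n × Fin m → A :=
    fun a => Sum.elim (fun z => (z : A)) fun q => e (a q.1) q.2
  have hA : ∀ c : A, (fun _ => c) ∈ jetFunctions D y := by
    intro c
    have hc : c ∈ Algebra.adjoin R (s : Set A) := hs ▸ Algebra.mem_top
    induction hc using Algebra.adjoin_induction with
    | mem z hz => exact coord_mem_jetFunctions (D := D) (y := y) (Sum.inl ⟨z, hz⟩)
    | algebraMap r => exact (jetFunctions D y).algebraMap_mem r
    | add a b _ _ ha hb => exact add_mem ha hb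
    | mul a b _ _ ha hb => exact mul_mem ha hb
  let Φ : NonUnitalSubalgebra R ((Fin n → B) → B) :=
    { carrier := {f | ∀ k, (fun a => e (f a) k) ∈ jetFunctions D y}
      add_mem' := fun {f g} hf hg k => by
        simp only [Pi.add_apply, map_add]
        exact add_mem (hf k) (hg k)
      zero_mem' := fun k => by
        simp only [Pi.zero_apply, map_zero]
        exact hA 0
      mul_mem' := fun {f g} hf hg =>
        hmul (jetFunctions D y) (fun j φ hφ => deriv_mem_jetFunctions j hφ) f g hf hg
      smul_mem' := fun c f hf k => by
        simp only [Pi.smul_apply, map_smul]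
        exact (jetFunctions D y).smul_mem (hf k) c }
  have hΦ : ∀ f : EquationAlgebra M B n, (fun a => evalAt hB a f) ∈ Φ :=
    evalAt_mem_of_const_mem_of_coord_mem hB Φ (fun b k => hA (e b k))
      fun i k => coord_mem_jetFunctions (D := D) (y := y) (Sum.inr (i, k))
  let coord : EquationAlgebra M B n × Fin m → (Fin n → B) → A :=
    fun q a => e (evalAt hB a q.1) q.2
  obtain ⟨F, hF, hFfin, hFT⟩ := exists_finite_subset_jetFunctions (D := D) (y := y) hR
    (T := coord '' T ×ˢ Set.univ) (by rintro _ ⟨q, -, rfl⟩; exact hΦ q.1 q.2)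
  obtain ⟨G, hG, hGfin, rfl⟩ := hFfin.exists_subset_finite_image_eq hF
  refine ⟨Prod.fst '' G, ?_, hGfin.image _, fun a ha f hf => he ?_⟩
  · rintro _ ⟨q, hq, rfl⟩
    exact (hG hq).1
  · rw [map_zero]
    funext k
    refine hFT a ?_ (coord (f, k)) ⟨(f, k), ⟨hf, Set.mem_univ k⟩, rfl⟩
    rintro _ ⟨q, hq, rfl⟩
    change e (evalAt hB a q.1) q.2 = 0
    rw [ha q.1 ⟨q, hq, rfl⟩, map_zero, Pi.zero_apply]

end Equations

/-! ### Witt algebras -/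

section Witt

variable {R A : Type*} [CommRing R] [CommRing A] [Algebra R A] {m : ℕ}
  (D : DifferentialStructure R A m)

/-- The coefficients `f₁, …, fₘ` of `f₁ δ₁ + ⋯ + fₘ δₘ`. -/
def LeftSymmetricWitt.coeffs : LeftSymmetricWitt D →ₗ[R] Fin m → A where
  toFun f := f
  map_add' _ _ := rfl
  map_smul' _ _ := rfl

/-- The coefficients `f₁, …, fₘ` of `f₁ δ₁ + ⋯ + fₘ δₘ`. -/
def WittAlgebra.coeffs : CommutatorRing (WittAlgebra D) →ₗ[R] Fin m → A where
  toFun f := f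
  map_add' _ _ := rfl
  map_smul' _ _ := rfl

variable {D}

theorem LeftSymmetricWitt.mul_mem_of_forall_mem {Y : Type*} (Φ : Subalgebra R (Y → A))
    (hΦ : ∀ j, ∀ φ ∈ Φ, (fun x => D.δ j (φ x)) ∈ Φ) (f g : Y → LeftSymmetricWitt D)
    (hf : ∀ k, (fun x => f x k) ∈ Φ) (hg : ∀ k, (fun x => g x k) ∈ Φ) (k : Fin m) :
    (fun x => (f x * g x) k) ∈ Φ := by
  have h : (fun x => (f x * g x) k) = ∑ i, (fun x => f x i) * fun x => D.δ i (g x k) := by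
    funext x
    rw [LeftSymmetricWitt.mul_apply, Finset.sum_apply]
    rfl
  rw [h]
  exact sum_mem fun i _ => mul_mem (hf i) (hΦ i _ (hg k))

variable [IsDomain A] [Algebra ℚ R] [Algebra.FiniteType R A]

theorem LeftSymmetricWitt.isEquationallyNoetherian (hR : IsRadicallyNoetherian R) :
    IsEquationallyNoetherian R (LeftSymmetricWitt D) :=
  isEquationallyNoetherian_of_coordinates hR D (coeffs D) (fun _ _ h => h) fun Φ hΦ f g hf hg =>
    LeftSymmetricWitt.mul_mem_of_forall_mem Φ hΦ f g hf hg

theorem WittAlgebra.isEquationallyNoetherian (hR : IsRadicallyNoetherian R) :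
    IsEquationallyNoetherian R (CommutatorRing (WittAlgebra D)) :=
  isEquationallyNoetherian_of_coordinates hR D (coeffs D) (fun _ _ h => h)
    fun Φ hΦ f g hf hg k =>
      Φ.sub_mem (LeftSymmetricWitt.mul_mem_of_forall_mem Φ hΦ f g hf hg k)
        (LeftSymmetricWitt.mul_mem_of_forall_mem Φ hΦ g f hg hf k)

end Witt

end EqNoeth

theorem theorem4 {R : Type*} [CommRing R] [IsDomain R] [Algebra ℚ R]
    (hR : IsRadicallyNoetherian R) (m : ℕ) :
    EqNoeth.IsEquationallyNoetherian R (EqNoeth.LeftSymmetricWitt (EqNoeth.polyDiff R m)) ∧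
    EqNoeth.IsEquationallyNoetherian R
      (CommutatorRing (EqNoeth.WittAlgebra (EqNoeth.polyDiff R m))) :=
  ⟨EqNoeth.LeftSymmetricWitt.isEquationallyNoetherian hR,
    EqNoeth.WittAlgebra.isEquationallyNoetherian hR⟩
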